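/- **Setting.** All graphs are finite and simple. A *drawing* of a digraph maps the vertices to distinct points of the plane and every arc $(u,v)$ to a simple curve joining the points of $u$ and $v$ whose interior contains no vertex; an *edge crossing* is a point in which the interiors of two distinct arcs meet (counted once for each such pair of arcs), and the drawing is *planar* if it has none. It is *upward* if every arc $(u,v)$ is a curve that strictly increases in the vertical direction from $u$ to $v$. Two planar drawings define the same *embedding* if they have the same face boundaries and the same boundary of the external face. An *$st$-digraph* is an acyclic digraph with exactly one source $s$ and exactly one sink $t$; it is a *planar $st$-digraph* if it comes with an embedding in the plane in which $s$ and $t$ lie on the boundary of the external face. A drawing of a digraph $G'=(V,E')$, $E'\supseteq E$, *preserves* the embedded digraph $G=(V,E)$ if deleting the arcs of $E'\setminus E$ leaves a planar drawing of $G$ with the given embedding. An (acyclic) *HP-completion set* of $G=(V,E)$ with hamiltonian path $P=(s=v_1,\dots,v_n=t)$ is a set $E_c$ of arcs disjoint from $E$ such that $G'=(V,E\cup E_c)$ is acyclic, $P$ is a hamiltonian path of $G'$, and every arc of $E_c$ belongs to $P$. An HP-completion set together with an upward drawing of $G'$ that preserves $G$ is *crossing-optimal* if the drawing has the minimum number of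 edge crossings over all HP-completion sets of $G$ (with any hamiltonian path from $s$ to $t$) and all upward drawings of the corresponding $G'$ that preserve $G$. An *upward topological 2-page book embedding* of the embedded digraph $G$ is an upward planar drawing of $G$ with the given embedding in which all vertices lie on a vertical line, the spine (whose two sides are the two pages), and every arc meets the spine in only finitely many points. A *spine crossing* is a point in which the interior of an arc meets the spine. The book embedding is *spine-crossing-optimal* if it has the minimum number of spine crossings over all upward topological 2-page book embeddings of the embedded digraph $G$ (with any order of the vertices on the spine). **Theorem.** Let $G=(V,E)$ be a planar $st$-digraph with $n$ vertices, let $(v_1,\dots,v_n)$ be an ordering of $V$, and let $c\ge 0$ be an integer. Then $G$ has a crossing-optimal HP-completion set with hamiltonian path $P=(s=v_1,v_2,\dots,v_n=t)$ whose corresponding optimal drawing has $c$ edge crossings if and only if $G$ has a spine-crossing-optimal upward topological 2-page book embedding with $c$ spine crossings in which the vertices appear on the spine, from bottom to top, in the order $(s=v_1,v_2,\dots,v_n=t)$. -/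

import Mathlib

open Set

/-- The digraph with arc set `E` has no directed cycle. -/
def IsAcyclicDigraph {V : Type*} (E : Set (V × V)) : Prop :=
  ∀ x, ¬ Relation.TransGen (fun a b => (a, b) ∈ E) x x

/-- An acyclic digraph whose only source is `s` and whose only sink is `t`. -/
structure IsSTDigraph {V : Type*} (E : Set (V × V)) (s t : V) : Prop where
  acyclic : IsAcyclicDigraph E
  source : ∀ x, (∀ u, (u, x) ∉ E) ↔ x = s
  sink : ∀ x, (∀ u, (x, u) ∉ E) ↔ x = t

/-- A drawing in the plane of the digraph with arc set `E`: distinct points for the vertices, and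
for every arc a simple curve joining its end-vertices whose interior contains no vertex. -/
structure Drawing {V : Type*} (E : Set (V × V)) where
  pos : V → ℝ × ℝ
  pos_injective : Function.Injective pos
  curve : ∀ e : E, Path (pos e.1.1) (pos e.1.2)
  curve_injective : ∀ e, Function.Injective (curve e)
  curve_avoids : ∀ e x, pos x ∉ curve e '' Ioo 0 1

namespace Drawing

variable {V : Type*} {E E' : Set (V × V)}

/-- The curve of an arc, without its two end-points. -/
def inner (D : Drawing E) (e : E) : Set (ℝ × ℝ) := D.curve e '' Ioo 0 1

/-- Every arc is strictly increasing in the vertical direction. -/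
def IsUpward (D : Drawing E) : Prop := ∀ e, StrictMono fun τ => (D.curve e τ).2

/-- The edge crossings: a point at which two distinct arcs meet away from their end-vertices,
recorded together with the unordered pair of arcs. -/
def crossings (D : Drawing E) : Set (Sym2 E × (ℝ × ℝ)) :=
  {c | ∃ e f : E, e ≠ f ∧ c.1 = s(e, f) ∧ c.2 ∈ D.inner e ∩ D.inner f}

/-- Distinct arcs meet at most in end-vertices. -/
def IsPlanar (D : Drawing E) : Prop := ∀ e f, e ≠ f → Disjoint (D.inner e) (D.inner f)

/-- Delete from a drawing the arcs outside `E`. -/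
def restrict (D : Drawing E') (h : E ⊆ E') : Drawing E where
  pos := D.pos
  pos_injective := D.pos_injective
  curve e := D.curve ⟨e.1, h e.2⟩
  curve_injective e := D.curve_injective ⟨e.1, h e.2⟩
  curve_avoids e := D.curve_avoids ⟨e.1, h e.2⟩

/-- The set of all points of the plane that are used by the drawing. -/
def support (D : Drawing E) : Set (ℝ × ℝ) := range D.pos ∪ ⋃ e, range (D.curve e)

/-- The faces: the connected components of the complement of the drawing. -/
def IsFace (D : Drawing E) (C : Set (ℝ × ℝ)) : Prop :=
  ∃ p ∈ D.supportᶜ, C = connectedComponentIn D.supportᶜ p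

/-- The external face: the unbounded one. -/
def IsExternalFace (D : Drawing E) (C : Set (ℝ × ℝ)) : Prop :=
  D.IsFace C ∧ ¬ Bornology.IsBounded C

/-- The boundary of a face, as the sets of vertices and arcs that lie on it. -/
def boundary (D : Drawing E) (C : Set (ℝ × ℝ)) : Set V × Set E :=
  ({x | D.pos x ∈ frontier C}, {e | range (D.curve e) ⊆ frontier C})

/-- Two drawings define the same face boundaries and the same boundary of the external face. -/
def SameEmbedding (D₁ D₂ : Drawing E) : Prop :=
  {b | ∃ C, D₁.IsFace C ∧ b = D₁.boundary C} = {b | ∃ C, D₂.IsFace C ∧ b = D₂.boundary C} ∧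
  {b | ∃ C, D₁.IsExternalFace C ∧ b = D₁.boundary C} =
    {b | ∃ C, D₂.IsExternalFace C ∧ b = D₂.boundary C}

/-- The drawing `D` of a supergraph preserves the embedded planar graph given by the planar
drawing `Γ`: deleting the additional arcs leaves a planar drawing with the embedding of `Γ`. -/
def Preserves (D : Drawing E') (h : E ⊆ E') (Γ : Drawing E) : Prop :=
  (D.restrict h).IsPlanar ∧ (D.restrict h).SameEmbedding Γ

/-- An upward topological 2-page book embedding of the embedded planar digraph given by `Γ`. The
spine is the vertical line `x = 0` and the pages are the two half-planes bounded by it. All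
vertices lie on the spine, the arcs are drawn upward and do not cross each other, and each arc
meets the spine in finitely many points, so that it consists of finitely many pieces each of which
runs within one page. -/
structure IsUpwardBookEmbedding (D : Drawing E) (Γ : Drawing E) : Prop where
  spine : ∀ x, (D.pos x).1 = 0
  upward : D.IsUpward
  planar : D.IsPlanar
  embedding : D.SameEmbedding Γ
  finite : ∀ e, {p ∈ D.inner e | p.1 = 0}.Finite

/-- The spine crossings: the points at which the arcs, away from their end-vertices, meet the
spine `x = 0`. -/
def spineCrossings (D : Drawing E) : Set (E × (ℝ × ℝ)) := {c | c.2 ∈ D.inner c.1 ∧ c.2.1 = 0}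

end Drawing

/-- `Ec` is an acyclic HP-completion set of the digraph with arc set `E`, and `v` is the resulting
hamiltonian path, which leads from `s` to `t` and uses every arc of `Ec`. -/
structure IsHPCompletionSet {V : Type*} {n : ℕ} (E Ec : Set (V × V)) (s t : V) (v : Fin n ≃ V) :
    Prop where
  disjoint : Disjoint E Ec
  acyclic : IsAcyclicDigraph (E ∪ Ec)
  first : ∀ i : Fin n, (i : ℕ) = 0 → v i = s
  last : ∀ i : Fin n, (i : ℕ) + 1 = n → v i = t
  path : ∀ i j : Fin n, (j : ℕ) = i + 1 → (v i, v j) ∈ E ∪ Ec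
  used : ∀ e ∈ Ec, ∃ i j : Fin n, (j : ℕ) = i + 1 ∧ e = (v i, v j)

/-- `D` is an upward drawing, preserving the embedding given by `Γ`, of the digraph that is
HP-completed by `Ec`, and it has the minimum number of edge crossings over all acyclic
HP-completion sets and all such drawings. -/
def IsCrossingOptimal {V : Type*} [Fintype V] {E : Set (V × V)} (Γ : Drawing E) (s t : V)
    {Ec : Set (V × V)} (D : Drawing (E ∪ Ec)) : Prop :=
  D.IsUpward ∧ D.Preserves subset_union_left Γ ∧
  ∀ (Ec' : Set (V × V)) (v' : Fin (Fintype.card V) ≃ V), IsHPCompletionSet E Ec' s t v' →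
    ∀ D' : Drawing (E ∪ Ec'), D'.IsUpward → D'.Preserves subset_union_left Γ →
      D.crossings.encard ≤ D'.crossings.encard

/-- `D` is an upward topological 2-page book embedding with the minimum number of spine crossings,
over all orders of the vertices on the spine. -/
def IsSpineCrossingOptimal {V : Type*} {E : Set (V × V)} (Γ : Drawing E) (D : Drawing E) : Prop :=
  D.IsUpwardBookEmbedding Γ ∧
  ∀ D' : Drawing E, D'.IsUpwardBookEmbedding Γ →
    D.spineCrossings.encard ≤ D'.spineCrossings.encard

/-! Both directions come from a correspondence that keeps the order of the vertices and does not
increase the number of crossings; hence the two minima agree.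

From an upward drawing of an HP-completed digraph to a book embedding: the arcs are graphs over the
height, and the hamiltonian path is a graph `x = p y` through all vertices. Where the path uses an
arc of `E`, it is pushed slightly aside, off every arc of `E`; where it uses an added arc, it
follows it (`exists_clear_graph`, `IsHPCompletionSet.exists_spine`). The homeomorphism `(x, y) ↦ (x
- p y, y)` straightens this curve to the spine and keeps heights and faces. Every spine crossing
then comes from a crossing of an arc of `E` with an added arc
(`IsHPCompletionSet.exists_bookEmbedding`).

Conversely, the spine segments between consecutive nonadjacent vertices complete the path, and their
crossings with `E` are spine crossings (`IsUpwardBookEmbedding.exists_hpCompletionSet`). -/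

namespace Drawing

variable {V : Type*} {E Ec : Set (V × V)}

/-! ### Invariance of the embedding under homeomorphisms of the plane -/

/-- The image of a drawing under a homeomorphism of the plane. -/
def map (D : Drawing E) (h : (ℝ × ℝ) ≃ₜ (ℝ × ℝ)) : Drawing E where
  pos x := h (D.pos x)
  pos_injective := h.injective.comp D.pos_injective
  curve e := (D.curve e).map h.continuous
  curve_injective e := h.injective.comp (D.curve_injective e)
  curve_avoids e x := by
    rintro ⟨τ, hτ, hx⟩
    exact D.curve_avoids e x ⟨τ, hτ, h.injective hx⟩

theorem inner_map (D : Drawing E) (h : (ℝ × ℝ) ≃ₜ (ℝ × ℝ)) (e : E) :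
    (D.map h).inner e = h '' D.inner e :=
  image_comp h (D.curve e) (Ioo 0 1)

theorem range_curve_map (D : Drawing E) (h : (ℝ × ℝ) ≃ₜ (ℝ × ℝ)) (e : E) :
    range ((D.map h).curve e) = h '' range (D.curve e) :=
  range_comp h (D.curve e)

theorem support_map (D : Drawing E) (h : (ℝ × ℝ) ≃ₜ (ℝ × ℝ)) :
    (D.map h).support = h '' D.support := by
  simp only [support, image_union, image_iUnion, range_curve_map]
  exact congrArg₂ _ (range_comp h D.pos) rfl

theorem isFace_map_iff (D : Drawing E) (h : (ℝ × ℝ) ≃ₜ (ℝ × ℝ)) (C : Set (ℝ × ℝ)) :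
    (D.map h).IsFace (h '' C) ↔ D.IsFace C := by
  have key : ∀ p ∈ D.supportᶜ, connectedComponentIn (D.map h).supportᶜ (h p) =
      h '' connectedComponentIn D.supportᶜ p := by
    intro p hp
    rw [h.image_connectedComponentIn hp, support_map, image_compl_eq h.bijective]
  have hsupp : (D.map h).supportᶜ = h '' D.supportᶜ := by
    rw [support_map, image_compl_eq h.bijective]
  constructor
  · rintro ⟨p', hp', hC⟩
    rw [hsupp] at hp'
    obtain ⟨p, hp, rfl⟩ := hp'
    rw [key p hp] at hC
    exact ⟨p, hp, h.injective.image_injective hC⟩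
  · rintro ⟨p, hp, rfl⟩
    exact ⟨h p, hsupp ▸ mem_image_of_mem h hp, (key p hp).symm⟩

/-- Bounded sets of the plane have compact closure, and compactness is preserved by continuous maps.
-/
theorem isBounded_image_homeomorph_iff (h : (ℝ × ℝ) ≃ₜ (ℝ × ℝ)) (C : Set (ℝ × ℝ)) :
    Bornology.IsBounded (h '' C) ↔ Bornology.IsBounded C := by
  have key : ∀ (g : (ℝ × ℝ) ≃ₜ (ℝ × ℝ)) (S : Set (ℝ × ℝ)), Bornology.IsBounded S →
      Bornology.IsBounded (g '' S) := fun g S hS =>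
    (hS.isCompact_closure.image g.continuous).isBounded.subset (image_mono subset_closure)
  refine ⟨fun H => ?_, key h C⟩
  simpa [image_image] using key h.symm _ H

theorem isExternalFace_map_iff (D : Drawing E) (h : (ℝ × ℝ) ≃ₜ (ℝ × ℝ)) (C : Set (ℝ × ℝ)) :
    (D.map h).IsExternalFace (h '' C) ↔ D.IsExternalFace C := by
  rw [IsExternalFace, IsExternalFace, isFace_map_iff, isBounded_image_homeomorph_iff]

theorem boundary_map (D : Drawing E) (h : (ℝ × ℝ) ≃ₜ (ℝ × ℝ)) (C : Set (ℝ × ℝ)) :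
    (D.map h).boundary (h '' C) = D.boundary C := by
  simp only [boundary, range_curve_map, ← h.image_frontier, image_subset_image_iff h.injective]
  exact congrArg (·, _) (Set.ext fun x => h.injective.mem_set_image)

theorem sameEmbedding_map (D : Drawing E) (h : (ℝ × ℝ) ≃ₜ (ℝ × ℝ)) :
    (D.map h).SameEmbedding D := by
  have hs : ∀ C', ∃ C, C' = h '' C := fun C' => ⟨h ⁻¹' C', by simp⟩
  constructor <;> ext b <;> constructor
  · rintro ⟨C', hC', rfl⟩
    obtain ⟨C, rfl⟩ := hs C'
    exact ⟨C, (D.isFace_map_iff h C).1 hC', D.boundary_map h C⟩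
  · rintro ⟨C, hC, rfl⟩
    exact ⟨h '' C, (D.isFace_map_iff h C).2 hC, (D.boundary_map h C).symm⟩
  · rintro ⟨C', hC', rfl⟩
    obtain ⟨C, rfl⟩ := hs C'
    exact ⟨C, (D.isExternalFace_map_iff h C).1 hC', D.boundary_map h C⟩
  · rintro ⟨C, hC, rfl⟩
    exact ⟨h '' C, (D.isExternalFace_map_iff h C).2 hC, (D.boundary_map h C).symm⟩

theorem SameEmbedding.trans {D₁ D₂ D₃ : Drawing E} (h₁ : D₁.SameEmbedding D₂)
    (h₂ : D₂.SameEmbedding D₃) : D₁.SameEmbedding D₃ :=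
  ⟨h₁.1.trans h₂.1, h₁.2.trans h₂.2⟩

/-! ### Upward arcs as graphs over the height -/

theorem IsUpward.lt {D : Drawing E} (hD : D.IsUpward) (e : E) :
    (D.pos e.1.1).2 < (D.pos e.1.2).2 := by
  simpa using hD e (zero_lt_one : (0 : unitInterval) < 1)

/-- In an upward drawing, an arc is the part of the graph of a continuous function of the height
between its two end-vertices. -/
theorem IsUpward.exists_graph {D : Drawing E} (hD : D.IsUpward) (e : E) :
    ∃ X : ℝ → ℝ, Continuous X ∧ X (D.pos e.1.1).2 = (D.pos e.1.1).1 ∧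
      X (D.pos e.1.2).2 = (D.pos e.1.2).1 ∧
      ∀ p, p ∈ D.inner e ↔ p.2 ∈ Ioo (D.pos e.1.1).2 (D.pos e.1.2).2 ∧ p.1 = X p.2 := by
  have hcont : Continuous fun τ => (D.curve e τ).2 := by fun_prop
  -- The height embeds the unit interval as a closed subset of `ℝ`, so Tietze's theorem extends the
  -- abscissa, as a function of the height, to all of `ℝ`.
  obtain ⟨X, hX⟩ := ContinuousMap.exists_extension' (hcont.isClosedEmbedding (hD e).injective)
    (⟨fun τ => (D.curve e τ).1, by fun_prop⟩ : C(unitInterval, ℝ))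
  have hX' : ∀ τ, X (D.curve e τ).2 = (D.curve e τ).1 := fun τ => congrFun hX τ
  refine ⟨X, X.continuous, by simpa using hX' 0, by simpa using hX' 1, fun p => ?_⟩
  constructor
  · rintro ⟨τ, hτ, rfl⟩
    refine ⟨⟨?_, ?_⟩, (hX' τ).symm⟩
    · simpa using hD e hτ.1
    · simpa using hD e hτ.2
  · rintro ⟨hp, hpX⟩
    have hIVT := intermediate_value_Ioo (zero_le_one : (0 : unitInterval) ≤ 1)
      (f := fun τ => (D.curve e τ).2) hcont.continuousOn
    simp only [Path.source, Path.target] at hIVT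
    obtain ⟨τ, hτ, hτp⟩ := hIVT hp
    refine ⟨τ, hτ, Prod.ext ?_ hτp⟩
    rw [hpX, ← hX', ← hτp]

end Drawing

/-! ### Small perturbations, gluing and straightening -/

/-- A continuous function that vanishes at `a` and `b` and stays, in between, strictly between `0`
and each of finitely many given continuous functions. -/
theorem exists_continuous_lt {ι : Type*} (S : Finset ι) (d : ι → ℝ → ℝ) {a b : ℝ}
    (hd : ∀ i ∈ S, Continuous (d i)) (h0 : ∀ i ∈ S, ∀ y, 0 ≤ d i y)
    (hpos : ∀ i ∈ S, ∀ y ∈ Ioo a b, 0 < d i y) :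
    ∃ ε : ℝ → ℝ, Continuous ε ∧ ε a = 0 ∧ ε b = 0 ∧
      ∀ y ∈ Ioo a b, 0 < ε y ∧ ∀ i ∈ S, ε y < d i y := by
  classical
  induction S using Finset.induction_on with
  | empty =>
    exact ⟨fun y => (y - a) * (b - y), by fun_prop, by simp, by simp, fun y hy =>
      ⟨mul_pos (sub_pos.2 hy.1) (sub_pos.2 hy.2), by simp⟩⟩
  | insert j S _ ih =>
    simp only [Finset.forall_mem_insert] at hd h0 hpos
    obtain ⟨ε, hε, ha, hb, hy⟩ := ih hd.2 h0.2 hpos.2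
    have := hd.1
    -- Halving makes the bound strict; since `d j` is nonnegative also at `a` and `b`, the minimum
    -- still vanishes there.
    refine ⟨fun y => min (ε y) (d j y / 2), by fun_prop, ?_, ?_, fun y hyab => ⟨?_, ?_⟩⟩
    · simp only [ha, min_eq_left (div_nonneg (h0.1 a) zero_le_two)]
    · simp only [hb, min_eq_left (div_nonneg (h0.1 b) zero_le_two)]
    · exact lt_min (hy y hyab).1 (half_pos (hpos.1 y hyab))
    · rw [Finset.forall_mem_insert]
      exact ⟨(min_le_right _ _).trans_lt (half_lt_self (hpos.1 y hyab)),
        fun i hi => (min_le_left _ _).trans_lt ((hy y hyab).2 i hi)⟩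

/-- Continuous functions on consecutive intervals with matching values at the end-points can be
glued. -/
theorem exists_continuous_glue {n : ℕ} (y a : Fin n → ℝ) (hy : StrictMono y) (q : Fin n → ℝ → ℝ)
    (hq : ∀ i, Continuous (q i))
    (hqy : ∀ i j : Fin n, (j : ℕ) = i + 1 → q i (y i) = a i ∧ q i (y j) = a j) :
    ∃ p : ℝ → ℝ, Continuous p ∧ (∀ i, p (y i) = a i) ∧
      ∀ i j : Fin n, (j : ℕ) = i + 1 → EqOn p (q i) (Icc (y i) (y j)) := by
  suffices H : ∀ k : ℕ, ∃ p : ℝ → ℝ, Continuous p ∧ (∀ i : Fin n, (i : ℕ) ≤ k → p (y i) = a i) ∧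
      ∀ i j : Fin n, (j : ℕ) = i + 1 → (j : ℕ) ≤ k → EqOn p (q i) (Icc (y i) (y j)) by
    obtain ⟨p, hp, h1, h2⟩ := H n
    exact ⟨p, hp, fun i => h1 i i.2.le, fun i j hij => h2 i j hij j.2.le⟩
  intro k
  induction k with
  | zero =>
    refine ⟨fun _ => if h : 0 < n then a ⟨0, h⟩ else 0, by fun_prop, ?_, ?_⟩
    · intro i hi
      have hi0 : i = ⟨0, i.pos⟩ := Fin.ext (by simpa using hi)
      rw [dif_pos i.pos, ← hi0]
    · intro i j hij hj
      omega
  | succ k ih =>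
    obtain ⟨p, hp, h1, h2⟩ := ih
    by_cases hk : k + 1 < n
    · let i₀ : Fin n := ⟨k, by omega⟩
      let j₀ : Fin n := ⟨k + 1, hk⟩
      obtain ⟨hq1, hq2⟩ := hqy i₀ j₀ rfl
      have hle : ∀ i : Fin n, (i : ℕ) ≤ k → y i ≤ y i₀ := fun i hi => hy.monotone (Fin.le_def.2 hi)
      refine ⟨fun t => if t ≤ y i₀ then p t else q i₀ t, ?_, fun i hi => ?_, fun i j hij hj => ?_⟩
      · refine Continuous.if_le hp (hq _) continuous_id continuous_const fun t ht => ?_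
        rw [show t = y i₀ from ht, h1 i₀ le_rfl, hq1]
      · rcases hi.lt_or_eq with hi | hi
        · have hi' : (i : ℕ) ≤ k := by omega
          simp only [if_pos (hle i hi'), h1 i hi']
        · obtain rfl : i = j₀ := Fin.ext hi
          have : ¬ y j₀ ≤ y i₀ := not_le.2 (hy (Fin.lt_def.2 (by simp [i₀, j₀])))
          simp only [if_neg this, hq2]
      · intro t ht
        rcases hj.lt_or_eq with hj | hj
        · have hj' : (j : ℕ) ≤ k := by omega
          simp only [if_pos (ht.2.trans (hle j hj'))]
          exact h2 i j hij hj' ht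
        · obtain rfl : i = i₀ := Fin.ext (by simp only [i₀]; omega)
          by_cases htk : t ≤ y i₀
          · obtain rfl : t = y i₀ := le_antisymm htk ht.1
            simp only [le_refl, if_true, h1 i₀ le_rfl, hq1]
          · simp only [if_neg htk]
    · exact ⟨p, hp, fun i _ => h1 i (by omega), fun i j hij _ => h2 i j hij (by omega)⟩

/-- The homeomorphism of the plane that moves the graph `x = p y` to the line `x = 0`. -/
def shear (p : ℝ → ℝ) (hp : Continuous p) : (ℝ × ℝ) ≃ₜ (ℝ × ℝ) where
  toFun z := (z.1 - p z.2, z.2)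
  invFun z := (z.1 + p z.2, z.2)
  left_inv z := by simp
  right_inv z := by simp
  continuous_toFun := by fun_prop
  continuous_invFun := by fun_prop

/-- Supplies the vertex order of a competing book embedding, which is given only through the
heights. -/
theorem exists_equiv_strictMono {V : Type*} [Fintype V] (f : V → ℝ) (hf : Function.Injective f) :
    ∃ v : Fin (Fintype.card V) ≃ V, StrictMono fun i => f (v i) := by
  let _ : LinearOrder V := LinearOrder.lift' f hf
  have hmono : StrictMono f := fun _ _ h => h
  let o := Fintype.orderIsoFinOfCardEq V rfl
  exact ⟨o.toEquiv, hmono.comp o.strictMono⟩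

/-! ### From HP-completions to book embeddings -/

namespace Drawing

variable {V : Type*} {E Ec : Set (V × V)}

/-- An arc without vertices at intermediate heights can be replaced by a curve with the same
end-points that meets only arcs which the given arc crosses, and no arc of `E` at all if the given
arc belongs to `E`. -/
theorem exists_clear_graph [Finite V] {D : Drawing (E ∪ Ec)} (hD : D.IsUpward)
    (hpl : (D.restrict subset_union_left).IsPlanar) (e : ↥(E ∪ Ec))
    (he : ∀ x, (D.pos x).2 ∉ Ioo (D.pos e.1.1).2 (D.pos e.1.2).2) :
    ∃ q : ℝ → ℝ, Continuous q ∧ q (D.pos e.1.1).2 = (D.pos e.1.1).1 ∧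
      q (D.pos e.1.2).2 = (D.pos e.1.2).1 ∧
      ∀ y ∈ Ioo (D.pos e.1.1).2 (D.pos e.1.2).2, ∀ f : ↥(E ∪ Ec), f.1 ∈ E →
        (q y, y) ∈ D.inner f → e.1 ∉ E ∧ (q y, y) ∈ D.inner e := by
  choose X hX hX1 hX2 hXi using fun e => hD.exists_graph e
  by_cases heE : e.1 ∈ E
  -- Since no vertex lies at an intermediate height, these are the only other arcs of `E` that occur
  -- at heights strictly between the ends of `e`.
  · let S : Set ↥(E ∪ Ec) := {f | f.1 ∈ E ∧ f ≠ e ∧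
      (D.pos f.1.1).2 ≤ (D.pos e.1.1).2 ∧ (D.pos e.1.2).2 ≤ (D.pos f.1.2).2}
    have hS : S.Finite := S.toFinite
    obtain ⟨ε, hε, hε1, hε2, hεi⟩ := exists_continuous_lt hS.toFinset
      (fun f y => |X f y - X e y|) (a := (D.pos e.1.1).2) (b := (D.pos e.1.2).2)
      (fun f _ => ((hX f).sub (hX e)).abs) (fun f _ y => abs_nonneg _) (by
        intro f hf y hy
        obtain ⟨hfE, hfe, hf1, hf2⟩ := hS.mem_toFinset.1 hf
        refine abs_pos.2 (sub_ne_zero.2 fun heq => ?_)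
        have hdis : Disjoint (D.inner f) (D.inner e) := hpl ⟨f.1, hfE⟩ ⟨e.1, heE⟩
          fun h => hfe (Subtype.ext (congrArg (fun z : E => z.1) h))
        refine disjoint_left.1 hdis ((hXi f (X f y, y)).2 ⟨⟨?_, ?_⟩, rfl⟩)
          ((hXi e (X f y, y)).2 ⟨hy, heq⟩)
        · exact hf1.trans_lt hy.1
        · exact hy.2.trans_le hf2)
    refine ⟨fun y => X e y + ε y, (hX e).add hε, by simp [hε1, hX1], by simp [hε2, hX2], ?_⟩
    intro y hy f hfE hf
    exfalso
    obtain ⟨hfy, hfX⟩ := (hXi f _).1 hf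
    simp only at hfy hfX
    obtain ⟨hε0, hεS⟩ := hεi y hy
    by_cases hfe : f = e
    · subst hfe
      linarith
    · have hlow : (D.pos f.1.1).2 ≤ (D.pos e.1.1).2 :=
        not_lt.1 fun h => he f.1.1 ⟨h, hfy.1.trans hy.2⟩
      have hhigh : (D.pos e.1.2).2 ≤ (D.pos f.1.2).2 :=
        not_lt.1 fun h => he f.1.2 ⟨hy.1.trans hfy.2, h⟩
      have := hεS f (hS.mem_toFinset.2 ⟨hfE, hfe, hlow, hhigh⟩)
      rw [← hfX, add_sub_cancel_left, abs_of_pos hε0] at this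
      exact lt_irrefl _ this
  -- An arc outside `E` is followed exactly, so whatever the curve meets is crossed by `e`.
  · exact ⟨X e, hX e, hX1 e, hX2 e, fun y hy f _ _ => ⟨heE, (hXi e _).2 ⟨hy, rfl⟩⟩⟩

end Drawing

theorem strictMono_of_consecutive {n : ℕ} {y : Fin n → ℝ}
    (h : ∀ i j : Fin n, (j : ℕ) = i + 1 → y i < y j) : StrictMono y := by
  cases n with
  | zero => exact fun i => i.elim0
  | succ m => exact Fin.strictMono_iff_lt_succ.2 fun i => h _ _ (by simp)

theorem exists_consecutive_of_le_of_lt {n : ℕ} {y : Fin n → ℝ} (hy : StrictMono y) {r : ℝ}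
    {a b : Fin n} (ha : y a ≤ r) (hb : r < y b) :
    ∃ i j : Fin n, (j : ℕ) = i + 1 ∧ y i ≤ r ∧ r < y j := by
  obtain ⟨i, hi, hmax⟩ := Finset.exists_max_image (Finset.univ.filter fun i => y i ≤ r) id
    ⟨a, by simpa using ha⟩
  have hir : y i ≤ r := by simpa using hi
  have hib : (i : ℕ) < b := Fin.lt_def.1 (hy.lt_iff_lt.1 (hir.trans_lt hb))
  refine ⟨i, ⟨i + 1, by omega⟩, rfl, hir, not_le.1 fun hj => ?_⟩
  have := hmax ⟨i + 1, by omega⟩ (by simpa using hj)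
  simp [Fin.le_def] at this

theorem eq_of_consecutive_of_mem_Ioo {n : ℕ} {y : Fin n → ℝ} (hy : StrictMono y) {r : ℝ}
    {i j k l : Fin n} (hij : (j : ℕ) = i + 1) (hkl : (l : ℕ) = k + 1) (hr : r ∈ Ioo (y i) (y j))
    (hr' : r ∈ Ioo (y k) (y l)) : i = k ∧ j = l := by
  have h1 : (i : ℕ) < l := Fin.lt_def.1 (hy.lt_iff_lt.1 (hr.1.trans hr'.2))
  have h2 : (k : ℕ) < j := Fin.lt_def.1 (hy.lt_iff_lt.1 (hr'.1.trans hr.2))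
  constructor <;> apply Fin.ext <;> omega

theorem notMem_Ioo_of_consecutive {n : ℕ} {y : Fin n → ℝ} (hy : StrictMono y)
    {i j : Fin n} (hij : (j : ℕ) = i + 1) (k : Fin n) : y k ∉ Ioo (y i) (y j) := by
  intro h
  have h1 : (i : ℕ) < k := Fin.lt_def.1 (hy.lt_iff_lt.1 h.1)
  have h2 : (k : ℕ) < j := Fin.lt_def.1 (hy.lt_iff_lt.1 h.2)
  omega

/-- Consecutive vertices of the path are joined by upward arcs, so the path order is the order of
heights. -/
theorem IsHPCompletionSet.strictMono {V : Type*} {n : ℕ} {E Ec : Set (V × V)} {s t : V}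
    {v : Fin n ≃ V} (h : IsHPCompletionSet E Ec s t v) {D : Drawing (E ∪ Ec)} (hD : D.IsUpward) :
    StrictMono fun i => (D.pos (v i)).2 :=
  strictMono_of_consecutive fun i j hij => hD.lt ⟨_, h.path i j hij⟩

/-- An upward drawing of an HP-completed digraph admits a continuous curve, monotone in the
vertical direction, that passes through all vertices and meets the arcs of `E` only where these are
crossed by arcs outside `E`. -/
theorem IsHPCompletionSet.exists_spine {V : Type*} {n : ℕ} {E Ec : Set (V × V)}
    {s t : V} {v : Fin n ≃ V} (h : IsHPCompletionSet E Ec s t v) {D : Drawing (E ∪ Ec)}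
    (hD : D.IsUpward) (hpl : (D.restrict subset_union_left).IsPlanar) :
    ∃ p : ℝ → ℝ, Continuous p ∧ (∀ x, p (D.pos x).2 = (D.pos x).1) ∧
      ∀ f : ↥(E ∪ Ec), f.1 ∈ E → ∀ z ∈ D.inner f, z.1 = p z.2 →
        ∃ e : ↥(E ∪ Ec), e.1 ∉ E ∧ z ∈ D.inner e := by
  have : Finite V := Finite.of_equiv _ v
  have hy := h.strictMono hD
  -- The top vertex has no successor; there the condition is vacuous and the zero function serves as
  -- a dummy.
  have hq : ∀ i : Fin n, ∃ q : ℝ → ℝ, Continuous q ∧ ∀ j : Fin n, (j : ℕ) = i + 1 →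
      q (D.pos (v i)).2 = (D.pos (v i)).1 ∧ q (D.pos (v j)).2 = (D.pos (v j)).1 ∧
      ∀ r ∈ Ioo (D.pos (v i)).2 (D.pos (v j)).2, ∀ f : ↥(E ∪ Ec), f.1 ∈ E →
        (q r, r) ∈ D.inner f → ∃ e : ↥(E ∪ Ec), e.1 ∉ E ∧ (q r, r) ∈ D.inner e := by
    intro i
    by_cases hi : (i : ℕ) + 1 < n
    · have hno : ∀ x, (D.pos x).2 ∉ Ioo (D.pos (v i)).2 (D.pos (v ⟨i + 1, hi⟩)).2 := by
        intro x
        simpa using notMem_Ioo_of_consecutive hy (i := i) (j := ⟨i + 1, hi⟩) rfl (v.symm x)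
      obtain ⟨q, hq, hq1, hq2, hq3⟩ :=
        Drawing.exists_clear_graph hD hpl ⟨_, h.path i ⟨i + 1, hi⟩ rfl⟩ hno
      refine ⟨q, hq, fun j hij => ?_⟩
      obtain rfl : j = ⟨i + 1, hi⟩ := Fin.ext hij
      exact ⟨hq1, hq2, fun r hr f hf hfr => ⟨_, hq3 r hr f hf hfr⟩⟩
    · exact ⟨fun _ => 0, continuous_const, fun j hij => absurd j.2 (by omega)⟩
  choose q hqc hq using hq
  obtain ⟨p, hp, hpv, hpq⟩ := exists_continuous_glue (fun i => (D.pos (v i)).2)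
    (fun i => (D.pos (v i)).1) hy q hqc fun i j hij => ⟨(hq i j hij).1, (hq i j hij).2.1⟩
  refine ⟨p, hp, fun x => by simpa using hpv (v.symm x), fun f hf z hz hzp => ?_⟩
  obtain ⟨X, -, -, -, hX⟩ := hD.exists_graph f
  have hzf := ((hX z).1 hz).1
  obtain ⟨i, j, hij, hi, hj⟩ := exists_consecutive_of_le_of_lt hy
    (a := v.symm f.1.1) (b := v.symm f.1.2) (r := z.2) (by simpa using hzf.1.le)
    (by simpa using hzf.2)
  have hzq : z = (q i z.2, z.2) :=
    Prod.ext (hzp.trans (hpq i j hij ⟨hi, hj.le⟩)) rfl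
  rcases hi.lt_or_eq with hi | hi
  · rw [hzq] at hz
    obtain ⟨e, he, hez⟩ := (hq i j hij).2.2 z.2 ⟨hi, hj⟩ f hf hz
    exact ⟨e, he, hzq ▸ hez⟩
  -- At the height of a vertex the spine passes through that vertex, which the interior of `f`
  -- avoids.
  · refine absurd ?_ (D.curve_avoids f (v i))
    have : D.pos (v i) = z := Prod.ext ((hpv i).symm.trans ((congrArg p hi).trans hzp.symm)) hi
    exact this ▸ hz

/-- Straightening the hamiltonian path of an HP-completed digraph yields a book embedding. -/
theorem IsHPCompletionSet.exists_bookEmbedding {V : Type*} {n : ℕ} {E Ec : Set (V × V)}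
    {s t : V} {v : Fin n ≃ V} (h : IsHPCompletionSet E Ec s t v) {Γ : Drawing E}
    {D : Drawing (E ∪ Ec)} (hD : D.IsUpward) (hpres : D.Preserves subset_union_left Γ)
    (hfin : D.crossings.Finite) :
    ∃ D' : Drawing E, D'.IsUpwardBookEmbedding Γ ∧
      D'.spineCrossings.encard ≤ D.crossings.encard ∧ StrictMono fun i => (D'.pos (v i)).2 := by
  obtain ⟨hpl, hemb⟩ := hpres
  obtain ⟨p, hp, hpv, hcross⟩ := h.exists_spine hD hpl
  let g := shear p hp
  let D' : Drawing E := (D.restrict subset_union_left).map g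
  have hle : D'.spineCrossings.encard ≤ D.crossings.encard := by
    have key : ∀ c : D'.spineCrossings, ∃ d : D.crossings, d.1.2 = g.symm c.1.2 ∧
        ∃ e : ↥(E ∪ Ec), e.1 ∉ E ∧ d.1.1 = s(⟨c.1.1.1, Or.inl c.1.1.2⟩, e) := by
      rintro ⟨⟨f, w⟩, hw, hw0⟩
      rw [Drawing.inner_map] at hw
      obtain ⟨z, hz, rfl⟩ := hw
      obtain ⟨e, he, hez⟩ := hcross ⟨f.1, Or.inl f.2⟩ f.2 z hz (sub_eq_zero.1 hw0)
      refine ⟨⟨(s(⟨f.1, Or.inl f.2⟩, e), z), _, e, ?_, rfl, hz, hez⟩, by simp, e, he, rfl⟩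
      rintro rfl
      exact he f.2
    choose d hd e he hde using key
    -- Exactly one arc of the unordered pair lies in `E`, so the edge crossing determines the spine
    -- crossing.
    refine Function.Embedding.encard_le ⟨d, fun c c' hcc => Subtype.ext (Prod.ext ?_ ?_)⟩
    · have hs := hde c
      rw [hcc, hde c', Sym2.eq_iff] at hs
      rcases hs with hs | hs
      · exact Subtype.ext (congrArg (fun z : ↥(E ∪ Ec) => z.1) hs.1).symm
      · exact absurd (hs.1 ▸ c'.1.1.2 : (e c).1 ∈ E) (he c)
    · exact g.symm.injective ((hd c).symm.trans (hcc ▸ hd c'))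
  refine ⟨D', ⟨fun x => sub_eq_zero.2 (hpv x).symm, fun e => hD ⟨e.1, Or.inl e.2⟩, ?_,
    (Drawing.sameEmbedding_map _ g).trans hemb, fun e => ?_⟩, hle, h.strictMono hD⟩
  · intro e f hef
    rw [Drawing.inner_map, Drawing.inner_map, disjoint_image_iff g.injective]
    exact hpl e f hef
  · have hf : D'.spineCrossings.Finite := by
      rw [← encard_lt_top_iff] at hfin ⊢
      exact hle.trans_lt hfin
    exact hf.preimage (f := fun z => (e, z)) (Prod.mk_right_injective e).injOn

/-! ### From book embeddings to HP-completions -/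

/-- The straight path between two points. -/
def segmentPath (a b : ℝ × ℝ) : Path a b where
  toFun τ := a + (τ : ℝ) • (b - a)
  source' := by simp
  target' := by simp

theorem segmentPath_apply (a b : ℝ × ℝ) (τ : unitInterval) :
    segmentPath a b τ = a + (τ : ℝ) • (b - a) :=
  rfl

theorem strictMono_segmentPath {a b : ℝ × ℝ} (h : a.2 < b.2) :
    StrictMono fun τ => (segmentPath a b τ).2 := by
  intro τ σ hτσ
  have : (τ : ℝ) < σ := hτσ
  simp only [segmentPath_apply, Prod.snd_add, Prod.smul_snd, Prod.snd_sub, smul_eq_mul]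
  have := mul_lt_mul_of_pos_right this (sub_pos.2 h)
  linarith

namespace Drawing

variable {V : Type*} {E Ec : Set (V × V)}

open Classical in
/-- Add straight upward arcs between vertices without vertices at intermediate heights. -/
noncomputable def addSegments (D : Drawing E)
    (hlt : ∀ e ∈ Ec, (D.pos e.1).2 < (D.pos e.2).2)
    (hno : ∀ e ∈ Ec, ∀ x, (D.pos x).2 ∉ Ioo (D.pos e.1).2 (D.pos e.2).2) : Drawing (E ∪ Ec) where
  pos := D.pos
  pos_injective := D.pos_injective
  curve e := if h : e.1 ∈ E then D.curve ⟨e.1, h⟩ else segmentPath _ _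
  curve_injective e := by
    by_cases h : e.1 ∈ E
    · rw [dif_pos h]
      exact D.curve_injective ⟨e.1, h⟩
    · rw [dif_neg h]
      exact Function.Injective.of_comp
        (f := Prod.snd) (strictMono_segmentPath (hlt e.1 (e.2.resolve_left h))).injective
  curve_avoids e x := by
    by_cases h : e.1 ∈ E
    · rw [dif_pos h]
      exact D.curve_avoids ⟨e.1, h⟩ x
    · rw [dif_neg h]
      rintro ⟨τ, hτ, hx⟩
      have hmono := strictMono_segmentPath (hlt e.1 (e.2.resolve_left h))
      refine hno e.1 (e.2.resolve_left h) x ⟨?_, ?_⟩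
      · simpa [hx] using hmono hτ.1
      · simpa [hx] using hmono hτ.2

section

variable (D : Drawing E) (hlt : ∀ e ∈ Ec, (D.pos e.1).2 < (D.pos e.2).2)
  (hno : ∀ e ∈ Ec, ∀ x, (D.pos x).2 ∉ Ioo (D.pos e.1).2 (D.pos e.2).2)

theorem addSegments_curve_of_mem {e : ↥(E ∪ Ec)} (h : e.1 ∈ E) :
    (D.addSegments hlt hno).curve e = D.curve ⟨e.1, h⟩ :=
  dif_pos h

theorem addSegments_curve_of_notMem {e : ↥(E ∪ Ec)} (h : e.1 ∉ E) :
    (D.addSegments hlt hno).curve e = segmentPath (D.pos e.1.1) (D.pos e.1.2) :=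
  dif_neg h

theorem restrict_addSegments : (D.addSegments hlt hno).restrict subset_union_left = D := by
  have : ∀ e : E, (D.addSegments hlt hno).curve ⟨e.1, Or.inl e.2⟩ = D.curve e :=
    fun e => D.addSegments_curve_of_mem hlt hno e.2
  cases D
  simp only [restrict, mk.injEq]
  exact ⟨rfl, heq_of_eq (funext this)⟩

theorem isUpward_addSegments (hD : D.IsUpward) : (D.addSegments hlt hno).IsUpward := by
  intro e
  by_cases h : e.1 ∈ E
  · rw [addSegments_curve_of_mem D hlt hno h]
    exact hD ⟨e.1, h⟩
  · rw [addSegments_curve_of_notMem D hlt hno h]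
    exact strictMono_segmentPath (hlt e.1 (e.2.resolve_left h))

theorem fst_eq_zero_of_mem_inner_addSegments (hspine : ∀ x, (D.pos x).1 = 0) {e : ↥(E ∪ Ec)}
    (h : e.1 ∉ E) {z : ℝ × ℝ} (hz : z ∈ (D.addSegments hlt hno).inner e) : z.1 = 0 := by
  rw [inner, addSegments_curve_of_notMem D hlt hno h] at hz
  obtain ⟨τ, -, rfl⟩ := hz
  change (segmentPath (D.pos e.1.1) (D.pos e.1.2) τ).1 = 0
  simp [segmentPath_apply, hspine]

end

/-- Heights increase along directed paths; this makes the completed digraph acyclic once it is drawn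
upward. -/
theorem IsUpward.isAcyclicDigraph {D : Drawing E} (hD : D.IsUpward) : IsAcyclicDigraph E := by
  intro x hx
  have key : ∀ a b, Relation.TransGen (fun a b => (a, b) ∈ E) a b → (D.pos a).2 < (D.pos b).2 := by
    intro a b hab
    induction hab with
    | single h => exact hD.lt ⟨_, h⟩
    | tail _ h ih => exact ih.trans (hD.lt ⟨_, h⟩)
  exact lt_irrefl _ (key x x hx)

/-- Adding the missing segments of the spine to a book embedding HP-completes the digraph. -/
theorem IsUpwardBookEmbedding.exists_hpCompletionSet {n : ℕ} {s t : V} (hG : IsSTDigraph E s t)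
    {Γ D : Drawing E} (hD : D.IsUpwardBookEmbedding Γ) (v : Fin n ≃ V)
    (hv : StrictMono fun i => (D.pos (v i)).2) :
    ∃ Ec : Set (V × V), IsHPCompletionSet E Ec s t v ∧ ∃ D' : Drawing (E ∪ Ec),
      D'.IsUpward ∧ D'.Preserves subset_union_left Γ ∧
        D'.crossings.encard ≤ D.spineCrossings.encard := by
  let Ec : Set (V × V) := {e | e ∉ E ∧ ∃ i j : Fin n, (j : ℕ) = i + 1 ∧ e = (v i, v j)}
  have hlt : ∀ e ∈ Ec, (D.pos e.1).2 < (D.pos e.2).2 := by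
    rintro _ ⟨-, i, j, hij, rfl⟩
    exact hv (Fin.lt_def.2 (by omega))
  have hno : ∀ e ∈ Ec, ∀ x, (D.pos x).2 ∉ Ioo (D.pos e.1).2 (D.pos e.2).2 := by
    rintro _ ⟨-, i, j, hij, rfl⟩ x
    simpa using notMem_Ioo_of_consecutive hv hij (v.symm x)
  let D' := D.addSegments hlt hno
  have hup : D'.IsUpward := D.isUpward_addSegments hlt hno hD.upward
  have hres : D'.restrict subset_union_left = D := D.restrict_addSegments hlt hno
  have hinner : ∀ e : ↥(E ∪ Ec), ∀ h : e.1 ∈ E, D'.inner e = D.inner ⟨e.1, h⟩ := fun e h => by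
    rw [inner, inner, addSegments_curve_of_mem D hlt hno h]
    rfl
  -- Distinct added segments occupy disjoint open intervals of heights.
  have hseg : ∀ e f : ↥(E ∪ Ec), e.1 ∉ E → f.1 ∉ E → ∀ z ∈ D'.inner e, z ∈ D'.inner f → e = f := by
    intro e f he hf z hze hzf
    obtain ⟨-, i, j, hij, hei⟩ := e.2.resolve_left he
    obtain ⟨-, k, l, hkl, hfk⟩ := f.2.resolve_left hf
    obtain ⟨X, -, -, -, hX⟩ := hup.exists_graph e
    obtain ⟨Y, -, -, -, hY⟩ := hup.exists_graph f
    have h1 := ((hX z).1 hze).1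
    have h2 := ((hY z).1 hzf).1
    rw [hei] at h1
    rw [hfk] at h2
    obtain ⟨rfl, rfl⟩ := eq_of_consecutive_of_mem_Ioo hv hij hkl h1 h2
    exact Subtype.ext (hei.trans hfk.symm)
  refine ⟨Ec, ⟨disjoint_left.2 fun e he he' => he'.1 he, hup.isAcyclicDigraph, ?_, ?_, ?_,
    fun e he => he.2⟩, D', hup, ?_, ?_⟩
  · intro i hi
    -- An arc into the lowest vertex would have to start below it.
    refine (hG.source _).1 fun u hu => ?_
    obtain ⟨k, rfl⟩ := v.surjective u
    have := Fin.lt_def.1 (hv.lt_iff_lt.1 (hD.upward.lt ⟨_, hu⟩))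
    omega
  · intro i hi
    refine (hG.sink _).1 fun u hu => ?_
    obtain ⟨k, rfl⟩ := v.surjective u
    have := Fin.lt_def.1 (hv.lt_iff_lt.1 (hD.upward.lt ⟨_, hu⟩))
    omega
  · intro i j hij
    by_cases h : (v i, v j) ∈ E
    · exact Or.inl h
    · exact Or.inr ⟨h, i, j, hij, rfl⟩
  · rw [Preserves, hres]
    exact ⟨hD.planar, hD.embedding⟩
  · have key : ∀ c : D'.crossings, ∃ d : D.spineCrossings, c.1.2 = d.1.2 ∧
        ∃ e : ↥(E ∪ Ec), e.1 ∉ E ∧ c.1.2 ∈ D'.inner e ∧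
          c.1.1 = s(⟨d.1.1.1, Or.inl d.1.1.2⟩, e) := by
      have mixed : ∀ e f : ↥(E ∪ Ec), e.1 ∈ E → f.1 ∉ E → ∀ z ∈ D'.inner e, z ∈ D'.inner f →
          ∃ d : D.spineCrossings, z = d.1.2 ∧ ∃ g : ↥(E ∪ Ec), g.1 ∉ E ∧ z ∈ D'.inner g ∧
            s(e, f) = s(⟨d.1.1.1, Or.inl d.1.1.2⟩, g) := by
        intro e f he hf z hze hzf
        exact ⟨⟨(⟨e.1, he⟩, z), hinner e he ▸ hze,
          D.fst_eq_zero_of_mem_inner_addSegments hlt hno hD.spine hf hzf⟩, rfl, f, hf, hzf, rfl⟩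
      rintro ⟨c, e, f, hef, hc, hze, hzf⟩
      dsimp only
      rw [hc]
      by_cases he : e.1 ∈ E <;> by_cases hf : f.1 ∈ E
      · rw [hinner e he] at hze
        rw [hinner f hf] at hzf
        refine absurd hzf (disjoint_left.1 (hD.planar _ _ fun h => hef ?_) hze)
        exact Subtype.ext (congrArg (fun x : E => x.1) h)
      · exact mixed e f he hf _ hze hzf
      · simpa only [Sym2.eq_swap] using mixed f e hf he _ hzf hze
      · exact absurd (hseg e f he hf _ hze hzf) hef
    choose d hd e he hze hde using key
    -- By `hseg` the point determines the added segment, so the spine crossing determines the pair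
    -- of arcs.
    refine Function.Embedding.encard_le ⟨d, fun c c' hcc => Subtype.ext (Prod.ext ?_ ?_)⟩
    · have hz : c.1.2 = c'.1.2 := (hd c).trans (hcc ▸ (hd c').symm)
      have hee : e c = e c' := hseg _ _ (he c) (he c') _ (hze c) (hz ▸ hze c')
      rw [hde c, hde c', hee, hcc]
    · exact (hd c).trans (hcc ▸ (hd c').symm)

theorem pos_snd_injective_of_spine {D : Drawing E} (h : ∀ x, (D.pos x).1 = 0) :
    Function.Injective fun x => (D.pos x).2 :=
  fun x y hxy => D.pos_injective (Prod.ext ((h x).trans (h y).symm) hxy)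

end Drawing

/-- A planar `st`-digraph, embedded by a planar drawing `Γ` with `s` and `t` on the boundary of the
external face, has a crossing-optimal HP-completion set with hamiltonian path `v` and `c` crossings
iff it has a spine-crossing-optimal upward topological 2-page book embedding with `c` spine
crossings and with the vertices in the order `v` on the spine. -/
theorem mainTheorem3 {V : Type*} [Fintype V] (E : Set (V × V)) (s t : V)
    (hG : IsSTDigraph E s t) (Γ : Drawing E) (hΓ : Γ.IsPlanar)
    (hst : ∃ C, Γ.IsExternalFace C ∧ Γ.pos s ∈ frontier C ∧ Γ.pos t ∈ frontier C)
    (v : Fin (Fintype.card V) ≃ V) (c : ℕ) :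
    (∃ Ec : Set (V × V), IsHPCompletionSet E Ec s t v ∧
      ∃ D : Drawing (E ∪ Ec), IsCrossingOptimal Γ s t D ∧ D.crossings.encard = c) ↔
    (∃ D : Drawing E, IsSpineCrossingOptimal Γ D ∧ D.spineCrossings.encard = c ∧
      (StrictMono fun i => (D.pos (v i)).2) ∧
      (∀ i : Fin (Fintype.card V), (i : ℕ) = 0 → v i = s) ∧
      (∀ i : Fin (Fintype.card V), (i : ℕ) + 1 = Fintype.card V → v i = t)) := by
  constructor
  · rintro ⟨Ec, hEc, D, ⟨hup, hpres, hmin⟩, hc⟩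
    have hfin : D.crossings.Finite := finite_of_encard_eq_coe hc
    obtain ⟨D', hD', hle, hmono⟩ := hEc.exists_bookEmbedding hup hpres hfin
    have hlow : ∀ D'' : Drawing E, D''.IsUpwardBookEmbedding Γ →
        D.crossings.encard ≤ D''.spineCrossings.encard := by
      intro D'' hD''
      obtain ⟨w, hw⟩ := exists_equiv_strictMono _ (Drawing.pos_snd_injective_of_spine hD''.spine)
      obtain ⟨Ec', hEc', F, hF, hFp, hFc⟩ := hD''.exists_hpCompletionSet hG w hw
      exact (hmin Ec' w hEc' F hF hFp).trans hFc
    exact ⟨D', ⟨hD', fun D'' hD'' => hle.trans (hlow D'' hD'')⟩,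
      (le_antisymm hle (hlow D' hD')).trans hc, hmono, hEc.first, hEc.last⟩
  · rintro ⟨D, ⟨hD, hmin⟩, hc, hmono, -, -⟩
    obtain ⟨Ec, hEc, F, hF, hFp, hFc⟩ := hD.exists_hpCompletionSet hG v hmono
    have hlow : ∀ (Ec' : Set (V × V)) (v' : Fin (Fintype.card V) ≃ V),
        IsHPCompletionSet E Ec' s t v' → ∀ F' : Drawing (E ∪ Ec'), F'.IsUpward →
          F'.Preserves subset_union_left Γ → D.spineCrossings.encard ≤ F'.crossings.encard := by
      intro Ec' v' hEc' F' hF' hFp'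
      by_cases hfin : F'.crossings.Finite
      · obtain ⟨D', hD', hle, -⟩ := hEc'.exists_bookEmbedding hF' hFp' hfin
        exact (hmin D' hD').trans hle
      · rw [Set.Infinite.encard_eq hfin]
        exact le_top
    exact ⟨Ec, hEc, F, ⟨hF, hFp, fun Ec' v' h F' h1 h2 => hFc.trans (hlow Ec' v' h F' h1 h2)⟩,
      (le_antisymm hFc (hlow Ec v hEc F hF hFp)).trans hc⟩
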